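/- **Notation.** For a real matrix $A$ and $k\ge 1$, let $A^{(k)}$ be the $k$-multiplicative compound of $A$, i.e. the matrix of all $k\times k$ minors of $A$, with rows and columns indexed by increasing sequences of $k$ indices. For $A\in\mathbb{R}^{n\times n}$ let $A^{[k]}:=\frac{d}{d\varepsilon}(I_n+\varepsilon A)^{(k)}\big|_{\varepsilon=0}$ be the $k$-additive compound. For $p\in[1,\infty]$ let $|\cdot|_p$ be the $L_p$ norm, $\|\cdot\|_p$ the induced matrix norm, and $\mu_p(A):=\lim_{\varepsilon\downarrow 0}\frac{\|I+\varepsilon A\|_p-1}{\varepsilon}$ the induced log norm. For an invertible matrix $H$ let $|x|_{p,H}:=|Hx|_p$ and $\mu_{p,H}(A):=\mu_p(HAH^{-1})$. **Theorem.** Let $n\ge 1$, $k\in\{1,\dots,n\}$, $p\in\{1,2,\infty\}$, let $q$ satisfy $p^{-1}+q^{-1}=1$, and let $T\in\mathbb{R}^{n\times n}$ be invertible. Define the $k$-shifted log norm of $A\in\mathbb{R}^{n\times n}$ by $$\tau_{p,k}(A):=\operatorname{tr}(A)+(n-k)\,\mu_{q,T}(-A).$$ 1. For every $A\in\mathbb{R}^{n\times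 n}$, $$\mu_{p,T^{(k)}}\big(A^{[k]}\big)\le \tau_{p,k}(A).$$ 2. Consequently, the following condition, which involves no compound, is sufficient for $k$-contraction. Let $\Omega\subseteq\mathbb{R}^n$, let $f(t,x)$ be differentiable in $x$ at every $x\in\Omega$, $t\ge 0$, with Jacobian $J(t,x)=\frac{\partial f}{\partial x}(t,x)$, and let $\eta>0$ be such that $\tau_{p,k}(J(t,x))\le-\eta$ for all $t\ge 0$, $x\in\Omega$. Then the system $\dot x=f(t,x)$ is $k$-contracting on $\Omega$ with rate $\eta$ with respect to $|\cdot|_{p,T^{(k)}}$; that is, for all $0\le t_0\le t_1$, every solution $x:[t_0,t_1]\to\Omega$ of the system, and any $k$ solutions $w^1,\dots,w^k$ on $[t_0,t_1]$ of the variational equation $\dot w=J(t,x(t))\,w$ along $x$, $$\big|[w^1(t_1)\,\cdots\,w^k(t_1)]^{(k)}\big|_{p,T^{(k)}}\le e^{-\eta(t_1-t_0)}\,\big|[w^1(t_0)\,\cdots\,w^k(t_0)]^{(k)}\big|_{p,T^{(k)}}.$$ -/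

import Mathlib

open scoped Topology ENNReal Matrix

noncomputable section

/-- Increasing sequences of `k` indices from `{1, …, n}`; they index the rows and columns of the
`k`-compounds of an `n × n` matrix. -/
abbrev IncSeq (k n : ℕ) : Type := Fin k ↪o Fin n

/-- The `k`-multiplicative compound `A^{(k)}`: the matrix of all `k × k` minors of `A`. -/
def mulCompound {n m : ℕ} (k : ℕ) (A : Matrix (Fin n) (Fin m) ℝ) :
    Matrix (IncSeq k n) (IncSeq k m) ℝ :=
  Matrix.of fun α β => (A.submatrix α β).det

/-- The `k`-additive compound `A^{[k]}`: the derivative at `ε = 0` of `(I + ε A)^{(k)}`,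
taken entry by entry. -/
def addCompound {n : ℕ} (k : ℕ) (A : Matrix (Fin n) (Fin n) ℝ) :
    Matrix (IncSeq k n) (IncSeq k n) ℝ :=
  Matrix.of fun α β => deriv (fun ε : ℝ => mulCompound k (1 + ε • A) α β) 0

/-- The entries of `(I + ε A)^{(k)}` are differentiable in `ε`. -/
theorem hasDerivAt_mulCompound {n : ℕ} (k : ℕ) (A : Matrix (Fin n) (Fin n) ℝ)
    (α β : IncSeq k n) :
    HasDerivAt (fun ε : ℝ => mulCompound k (1 + ε • A) α β) (addCompound k A α β) 0 := by
  have h : DifferentiableAt ℝ (fun ε : ℝ => mulCompound k (1 + ε • A) α β) 0 := by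
    simp only [mulCompound, Matrix.of_apply, Matrix.det_apply, Matrix.submatrix_apply,
      Matrix.add_apply, Matrix.smul_apply, smul_eq_mul]
    fun_prop
  exact h.hasDerivAt

/-- The operator norm of a square matrix induced by the vector norm `|·|_p`. -/
def inducedNorm {ι : Type*} [Fintype ι] [DecidableEq ι] (p : ℝ≥0∞) [Fact (1 ≤ p)]
    (A : Matrix ι ι ℝ) : ℝ :=
  ‖(Matrix.toLpLin p p A).toContinuousLinearMap‖

/-- The log norm `μ_p(A) = lim_{ε ↓ 0} (‖I + ε A‖_p - 1) / ε`. -/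
def logNorm {ι : Type*} [Fintype ι] [DecidableEq ι] (p : ℝ≥0∞) [Fact (1 ≤ p)]
    (A : Matrix ι ι ℝ) : ℝ :=
  Filter.limUnder (𝓝[>] (0 : ℝ)) fun ε : ℝ => (inducedNorm p (1 + ε • A) - 1) / ε

/-- The limit that defines the log norm exists. -/
theorem tendsto_logNorm {ι : Type*} [Fintype ι] [DecidableEq ι] [Nonempty ι] (p : ℝ≥0∞)
    [Fact (1 ≤ p)] (A : Matrix ι ι ℝ) :
    Filter.Tendsto (fun ε : ℝ => (inducedNorm p (1 + ε • A) - 1) / ε) (𝓝[>] (0 : ℝ))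
      (𝓝 (logNorm p A)) := by
  set L := (Matrix.toLpLin p p A).toContinuousLinearMap
  have hn : ∀ ε : ℝ, inducedNorm p (1 + ε • A) = ‖ContinuousLinearMap.id ℝ _ + ε • L‖ := by
    intro ε
    unfold inducedNorm
    congr 1
    ext x i
    simp [L, Matrix.toLpLin_one]
  have h1 : ‖ContinuousLinearMap.id ℝ (WithLp p (ι → ℝ))‖ = 1 :=
    ContinuousLinearMap.norm_id
  have hconv : ConvexOn ℝ Set.univ fun ε : ℝ => inducedNorm p (1 + ε • A) := by
    refine ⟨convex_univ, fun x _ y _ a b ha hb hab => ?_⟩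
    simp only [hn, smul_eq_mul]
    have : ContinuousLinearMap.id ℝ (PiLp p fun _ : ι => ℝ) + (a * x + b * y) • L
        = a • (ContinuousLinearMap.id ℝ _ + x • L) + b • (ContinuousLinearMap.id ℝ _ + y • L) := by
      rw [show b = 1 - a by linarith]
      module
    rw [this]
    refine (norm_add_le _ _).trans ?_
    rw [norm_smul, norm_smul, Real.norm_of_nonneg ha, Real.norm_of_nonneg hb]
  have h0 : inducedNorm p (1 + (0 : ℝ) • A) = 1 := by
    rw [zero_smul, add_zero, inducedNorm, Matrix.toLpLin_one]
    exact h1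
  have hd := ConvexOn.hasDerivWithinAt_rightDeriv_of_mem_interior hconv (x := 0) (by simp)
  rw [hasDerivWithinAt_iff_tendsto_slope' (by simp)] at hd
  refine tendsto_nhds_limUnder ⟨_, hd.congr fun ε => ?_⟩
  rw [slope_def_field, h0, sub_zero]

/-- The log norm `μ_{p,H}(A) = μ_p(H A H⁻¹)` induced by the scaled norm `|x|_{p,H} = |H x|_p`. -/
def scaledLogNorm {ι : Type*} [Fintype ι] [DecidableEq ι] (p : ℝ≥0∞) [Fact (1 ≤ p)]
    (H A : Matrix ι ι ℝ) : ℝ :=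
  logNorm p (H * A * H⁻¹)

/-- The `k`-shifted log norm `tr(A) + (n - k) μ_{q,T}(-A)`. For `q` dual to `p` this is
`τ_{p,k}(A)`. -/
def kShiftedLogNorm {n : ℕ} (q : ℝ≥0∞) [Fact (1 ≤ q)] (T : Matrix (Fin n) (Fin n) ℝ) (k : ℕ)
    (A : Matrix (Fin n) (Fin n) ℝ) : ℝ :=
  A.trace + ((n : ℝ) - (k : ℝ)) * scaledLogNorm q T (-A)

/-- The scaled vector norm `|y|_{p,H} = |H y|_p`. -/
def scaledNorm {ι : Type*} [Fintype ι] (p : ℝ≥0∞) [Fact (1 ≤ p)] (H : Matrix ι ι ℝ)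
    (y : ι → ℝ) : ℝ :=
  ‖(WithLp.toLp p (H *ᵥ y) : PiLp p fun _ : ι => ℝ)‖

/-- The vector `[w¹ ⋯ wᵏ]^{(k)}` of all `k × k` minors of the matrix with columns `w¹, …, wᵏ`
(the single column of the `k`-multiplicative compound of an `n × k` matrix). -/
def compoundVector {n k : ℕ} (w : Fin k → Fin n → ℝ) : IncSeq k n → ℝ :=
  fun α => mulCompound k (Matrix.of fun (i : Fin n) (j : Fin k) => w j i) α
    (RelEmbedding.refl (· ≤ ·))

/-- The Jacobian matrix `J(t,x) = ∂f/∂x (t,x)`. -/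
def jacobian {n : ℕ} (f : ℝ → (Fin n → ℝ) → (Fin n → ℝ)) (t : ℝ) (x : Fin n → ℝ) :
    Matrix (Fin n) (Fin n) ℝ :=
  LinearMap.toMatrix' (fderiv ℝ (f t) x : (Fin n → ℝ) →ₗ[ℝ] (Fin n → ℝ))

/-- The system `ẋ = f(t,x)` on `Ω` is `k`-contracting with rate `η` with respect to `|·|_{p,H}`:
along each trajectory in `Ω`, for any `k` solutions `w¹, …, wᵏ` of the variational equation
`ẇ = J(t, x(t)) w`, the norm of `[w¹(t) ⋯ wᵏ(t)]^{(k)}` decays at least as `exp (-η t)`. -/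
def IsKContracting {n : ℕ} (k : ℕ) (p : ℝ≥0∞) [Fact (1 ≤ p)]
    (H : Matrix (IncSeq k n) (IncSeq k n) ℝ) (η : ℝ) (Ω : Set (Fin n → ℝ))
    (f : ℝ → (Fin n → ℝ) → (Fin n → ℝ)) : Prop :=
  ∀ (t₀ t₁ : ℝ), 0 ≤ t₀ → t₀ ≤ t₁ →
    ∀ (x : ℝ → Fin n → ℝ) (w : Fin k → ℝ → Fin n → ℝ),
      (∀ t ∈ Set.Icc t₀ t₁, x t ∈ Ω) →
      (∀ t ∈ Set.Icc t₀ t₁, HasDerivWithinAt x (f t (x t)) (Set.Icc t₀ t₁) t) →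
      (∀ j, ∀ t ∈ Set.Icc t₀ t₁,
        HasDerivWithinAt (w j) (jacobian f t (x t) *ᵥ w j t) (Set.Icc t₀ t₁) t) →
      scaledNorm p H (compoundVector fun j => w j t₁) ≤
        Real.exp (-η * (t₁ - t₀)) * scaledNorm p H (compoundVector fun j => w j t₀)

end

/-! By Cauchy–Binet the multiplicative compound is a homomorphism, so conjugating `A` by `T`
conjugates `A^{[k]}` by `T^{(k)}`. The trace is unchanged, and part 1 reduces to `T = 1` with `B = T
A T⁻¹` (`addCompound_conj`).

For `p = 1` the log norm is a maximum over columns. In column `β` of `B^{[k]}` the diagonal entry is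
the sum of `B i i` over `i ∈ β`, and the off-diagonal entries sum in absolute value to at most the
sum of `|B i j|` over `i ∉ β`, `j ∈ β`. Writing the diagonal entry as `tr B` minus the sum over `i ∉
β` leaves `n - k` terms, each bounded by a row sum of `-B`, hence by `μ_∞(-B)`
(`addCompound_colSum_le`). Transposition gives `p = ∞`. For `p = 2` the log norm bounds the
quadratic form, which sees only the symmetric part; after an orthogonal diagonalization the claim
concerns sums of `k` eigenvalues (`dotProduct_addCompound_mulVec_le`).

For part 2, the vector of minors solves `ẏ = J^{[k]} y` (`hasDerivWithinAt_compoundVector`), and a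
log norm bound gives exponential decay by Grönwall (`norm_le_exp_mul_of_logNorm_le`). -/

/-! ### Cauchy–Binet and the algebra of multiplicative compounds -/

theorem det_mul_eq_sum_minors {n k : ℕ} (X : Matrix (Fin k) (Fin n) ℝ)
    (Y : Matrix (Fin n) (Fin k) ℝ) :
    (X * Y).det = ∑ γ : IncSeq k n, (X.submatrix id γ).det * (Y.submatrix γ id).det := by
  set b := Pi.basisFun ℝ (Fin n)
  -- `φ` sends `x₁ ∧ ⋯ ∧ x_k` to `det (x_i Y)`. In the standard basis of the exterior power, the
  -- coordinates of the wedge of the rows of `X` are minors of `X`, and the values of `φ` are minors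
  -- of `Y`.
  set φ := exteriorPower.alternatingMapLinearEquiv
    ((Matrix.detRowAlternating (R := ℝ) (n := Fin k)).compLinearMap Y.vecMulLinear) with hφ
  have hφι (x : Fin k → Fin n → ℝ) :
      φ (exteriorPower.ιMulti ℝ k x) = Matrix.det (fun i => x i ᵥ* Y) := by
    rw [hφ, exteriorPower.alternatingMapLinearEquiv_apply_ιMulti]
    rfl
  have h1 : (X * Y).det = φ (exteriorPower.ιMulti ℝ k fun i j => X i j) := (hφι _).symm
  rw [h1, ← (b.exteriorPower k).sum_repr (exteriorPower.ιMulti ℝ k fun i j => X i j), map_sum,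
    ← Equiv.sum_comp Set.powersetCard.ofFinEmbEquiv]
  refine Finset.sum_congr rfl fun γ _ => ?_
  rw [map_smul, smul_eq_mul, exteriorPower.basis_repr_apply,
    exteriorPower.ιMultiDual_apply_ιMulti, exteriorPower.basis_apply, exteriorPower.ιMulti_family,
    hφι]
  congr 2
  · ext i j
    simp [b]
  · ext i j
    simp [b]

theorem mulCompound_mul {n m l : ℕ} (k : ℕ) (A : Matrix (Fin n) (Fin m) ℝ)
    (B : Matrix (Fin m) (Fin l) ℝ) :
    mulCompound k (A * B) = mulCompound k A * mulCompound k B := by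
  ext α β
  rw [Matrix.mul_apply]
  have h := det_mul_eq_sum_minors (A.submatrix α id) (B.submatrix id β)
  simpa [mulCompound, Matrix.submatrix_mul _ _ _ _ _ Function.bijective_id] using h

theorem mulCompound_transpose {n m : ℕ} (k : ℕ) (A : Matrix (Fin n) (Fin m) ℝ) :
    mulCompound k Aᵀ = (mulCompound k A)ᵀ := by
  ext α β
  simp only [mulCompound, Matrix.of_apply, Matrix.transpose_apply]
  rw [← Matrix.transpose_submatrix, Matrix.det_transpose]

theorem exists_notMem_range_of_ne {n k : ℕ} {α β : IncSeq k n} (h : α ≠ β) :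
    ∃ i, ∀ j, α i ≠ β j := by
  by_contra! hc
  refine h (OrderEmbedding.range_inj.mp ?_)
  refine Set.eq_of_subset_of_ncard_le ?_ ?_ (Set.finite_range _)
  · rintro _ ⟨i, rfl⟩
    obtain ⟨j, hj⟩ := hc i
    exact ⟨j, hj.symm⟩
  · rw [← Set.image_univ, ← Set.image_univ, Set.ncard_image_of_injective _ α.injective,
      Set.ncard_image_of_injective _ β.injective]

theorem mulCompound_diagonal {n : ℕ} (k : ℕ) (d : Fin n → ℝ) :
    mulCompound k (Matrix.diagonal d) = Matrix.diagonal fun α : IncSeq k n => ∏ r, d (α r) := by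
  ext α β
  by_cases h : α = β
  · subst h
    simp [mulCompound, Matrix.submatrix_diagonal _ _ α.injective]
  · obtain ⟨i, hi⟩ := exists_notMem_range_of_ne h
    rw [Matrix.diagonal_apply_ne _ h]
    exact Matrix.det_eq_zero_of_row_eq_zero i fun j => Matrix.diagonal_apply_ne _ (hi j)

theorem mulCompound_one {n : ℕ} (k : ℕ) :
    mulCompound k (1 : Matrix (Fin n) (Fin n) ℝ) = 1 := by
  rw [← Matrix.diagonal_one, mulCompound_diagonal]
  simp

theorem mulCompound_mul_inv {n : ℕ} (k : ℕ) {T : Matrix (Fin n) (Fin n) ℝ} (hT : IsUnit T) :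
    mulCompound k T * mulCompound k T⁻¹ = 1 := by
  rw [← mulCompound_mul, Matrix.mul_nonsing_inv _ ((Matrix.isUnit_iff_isUnit_det _).mp hT),
    mulCompound_one]

theorem mulCompound_inv {n : ℕ} (k : ℕ) {T : Matrix (Fin n) (Fin n) ℝ} (hT : IsUnit T) :
    (mulCompound k T)⁻¹ = mulCompound k T⁻¹ :=
  Matrix.inv_eq_right_inv (mulCompound_mul_inv k hT)

/-! ### Conjugation, transposition and linearity of the additive compound -/

theorem addCompound_eq {n k : ℕ} {A : Matrix (Fin n) (Fin n) ℝ}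
    {M : Matrix (IncSeq k n) (IncSeq k n) ℝ}
    (h : ∀ α β, HasDerivAt (fun ε : ℝ => mulCompound k (1 + ε • A) α β) (M α β) 0) :
    addCompound k A = M := by
  ext α β
  exact (hasDerivAt_mulCompound k A α β).unique (h α β)

theorem addCompound_conj {n : ℕ} (k : ℕ) {T : Matrix (Fin n) (Fin n) ℝ} (hT : IsUnit T)
    (A : Matrix (Fin n) (Fin n) ℝ) :
    addCompound k (T * A * T⁻¹) =
      mulCompound k T * addCompound k A * (mulCompound k T)⁻¹ := by
  refine addCompound_eq fun α β => ?_
  have h (ε : ℝ) : mulCompound k (1 + ε • (T * A * T⁻¹)) =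
      mulCompound k T * mulCompound k (1 + ε • A) * (mulCompound k T)⁻¹ := by
    rw [mulCompound_inv k hT, ← mulCompound_mul, ← mulCompound_mul, Matrix.mul_add,
      Matrix.add_mul, Matrix.mul_one,
      Matrix.mul_nonsing_inv _ ((Matrix.isUnit_iff_isUnit_det _).mp hT)]
    simp
  simp only [h, Matrix.mul_apply]
  exact HasDerivAt.fun_sum fun γ _ => (HasDerivAt.fun_sum fun δ _ =>
    (hasDerivAt_mulCompound k A δ γ).const_mul _).mul_const _

theorem addCompound_transpose {n : ℕ} (k : ℕ) (A : Matrix (Fin n) (Fin n) ℝ) :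
    addCompound k Aᵀ = (addCompound k A)ᵀ := by
  refine addCompound_eq fun α β => ?_
  have h (ε : ℝ) : mulCompound k (1 + ε • Aᵀ) = (mulCompound k (1 + ε • A))ᵀ := by
    rw [← mulCompound_transpose]
    simp
  simp only [h, Matrix.transpose_apply]
  exact hasDerivAt_mulCompound k A β α

theorem differentiable_det_submatrix {ι κ μ : Type*} [Fintype ι] [Fintype κ] [Fintype μ]
    [DecidableEq μ] (r : μ → ι) (c : μ → κ) :
    Differentiable ℝ fun X : ι → κ → ℝ => ((Matrix.of X).submatrix r c).det := by
  simp only [Matrix.det_apply, Matrix.submatrix_apply, Matrix.of_apply]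
  fun_prop

/-- A Fréchet derivative is linear in its direction; this makes the additive compound linear in `A`.
-/
theorem addCompound_apply_eq_fderiv {n : ℕ} (k : ℕ) (A : Matrix (Fin n) (Fin n) ℝ)
    (α β : IncSeq k n) :
    addCompound k A α β = fderiv ℝ (fun X : Fin n → Fin n → ℝ =>
      ((Matrix.of X).submatrix α β).det) (fun i j => (1 : Matrix (Fin n) (Fin n) ℝ) i j)
      (fun i j => A i j) := by
  refine (hasDerivAt_mulCompound k A α β).unique ?_
  have h1 : HasDerivAt (fun ε : ℝ => (fun i j => (1 : Matrix (Fin n) (Fin n) ℝ) i j +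
      ε * A i j : Fin n → Fin n → ℝ)) (fun i j => A i j) 0 := by
    refine hasDerivAt_pi.2 fun i => hasDerivAt_pi.2 fun j => ?_
    simpa using ((hasDerivAt_id (0 : ℝ)).mul_const (A i j)).const_add
      ((1 : Matrix (Fin n) (Fin n) ℝ) i j)
  have h2 := (differentiable_det_submatrix α β
    fun i j => (1 : Matrix (Fin n) (Fin n) ℝ) i j + 0 * A i j).hasFDerivAt.comp_hasDerivAt 0 h1
  simp only [zero_mul, add_zero] at h2
  exact h2

theorem addCompound_add {n : ℕ} (k : ℕ) (A B : Matrix (Fin n) (Fin n) ℝ) :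
    addCompound k (A + B) = addCompound k A + addCompound k B := by
  ext α β
  simp only [Matrix.add_apply, addCompound_apply_eq_fderiv, ← map_add]
  rfl

theorem addCompound_smul {n : ℕ} (k : ℕ) (c : ℝ) (A : Matrix (Fin n) (Fin n) ℝ) :
    addCompound k (c • A) = c • addCompound k A := by
  ext α β
  simp only [Matrix.smul_apply, addCompound_apply_eq_fderiv, ← map_smul]
  rfl

/-- The additive compound as a linear map. -/
noncomputable def addCompoundLinear (n k : ℕ) :
    Matrix (Fin n) (Fin n) ℝ →ₗ[ℝ] Matrix (IncSeq k n) (IncSeq k n) ℝ where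
  toFun := addCompound k
  map_add' := addCompound_add k
  map_smul' := addCompound_smul k

theorem addCompound_sum_smul {n : ℕ} (k : ℕ) {ι : Type*} (s : Finset ι) (c : ι → ℝ)
    (A : ι → Matrix (Fin n) (Fin n) ℝ) :
    addCompound k (∑ x ∈ s, c x • A x) = ∑ x ∈ s, c x • addCompound k (A x) := by
  have := map_sum (addCompoundLinear n k) (fun x => c x • A x) s
  simp only [map_smul] at this
  exact this

theorem addCompound_diagonal {n : ℕ} (k : ℕ) (d : Fin n → ℝ) :
    addCompound k (Matrix.diagonal d) =
      Matrix.diagonal fun α : IncSeq k n => ∑ r, d (α r) := by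
  refine addCompound_eq fun α β => ?_
  have h (ε : ℝ) : 1 + ε • Matrix.diagonal d = Matrix.diagonal fun i => 1 + ε * d i := by
    rw [← Matrix.diagonal_one, ← Matrix.diagonal_smul, Matrix.diagonal_add]
    rfl
  simp only [h, mulCompound_diagonal]
  by_cases hαβ : α = β
  · subst hαβ
    simp only [Matrix.diagonal_apply_eq]
    have := HasDerivAt.fun_finsetProd (u := Finset.univ) (x := (0 : ℝ))
      (f := fun r ε => 1 + ε * d (α r)) (f' := fun r => d (α r)) fun r _ => by
        simpa using ((hasDerivAt_id (0 : ℝ)).mul_const (d (α r))).const_add 1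
    simpa using this
  · simp only [Matrix.diagonal_apply_ne _ hαβ]
    exact hasDerivAt_const _ _

/-! ### Entries and column sums of the additive compound -/

theorem addCompound_single_of_notMem {n k : ℕ} (i j : Fin n) (α β : IncSeq k n)
    (hj : ∀ s, β s ≠ j) : addCompound k (Matrix.single i j 1) α β = 0 := by
  refine (hasDerivAt_mulCompound k _ α β).unique ?_
  have h (ε : ℝ) : mulCompound k (1 + ε • Matrix.single i j (1 : ℝ)) α β =
      mulCompound k 1 α β := by
    simp only [mulCompound, Matrix.of_apply]
    congr 1
    ext r c
    simp [(hj c).symm]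
  simp only [h]
  exact hasDerivAt_const _ _

/-- Only column `s` of the minor involves `ε`, so the minor is affine in `ε`; its slope is the
determinant with that column replaced. -/
theorem addCompound_single_apply {n k : ℕ} (i : Fin n) (α β : IncSeq k n) (s : Fin k) :
    addCompound k (Matrix.single i (β s) 1) α β =
      ((1 : Matrix (Fin n) (Fin n) ℝ).submatrix α fun c => if c = s then i else β c).det := by
  refine (hasDerivAt_mulCompound k _ α β).unique ?_
  set N := (1 : Matrix (Fin n) (Fin n) ℝ).submatrix α β with hN
  set v : Fin k → ℝ := fun r => (1 : Matrix (Fin n) (Fin n) ℝ) (α r) i with hv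
  have h (ε : ℝ) : mulCompound k (1 + ε • Matrix.single i (β s) (1 : ℝ)) α β =
      N.det + ε * (N.updateCol s v).det := by
    rw [← Matrix.det_updateCol_smul, ← Matrix.updateCol_eq_self N s]
    simp only [Matrix.updateCol_idem]
    rw [← Matrix.det_updateCol_add]
    simp only [mulCompound, Matrix.of_apply]
    congr 1
    ext r c
    by_cases hc : c = s
    · subst hc
      simp [hN, hv, Matrix.single_apply, Matrix.one_apply, eq_comm]
    · simp [hN, hc, β.injective.eq_iff, Ne.symm hc]
  have h2 : (1 : Matrix (Fin n) (Fin n) ℝ).submatrix α (fun c => if c = s then i else β c) =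
      N.updateCol s v := by
    ext r c
    by_cases hc : c = s
    · subst hc
      simp [hv, Matrix.one_apply]
    · simp [hN, hc, Matrix.one_apply]
  simp only [h, h2]
  simpa using ((hasDerivAt_id (0 : ℝ)).mul_const (N.updateCol s v).det).const_add N.det

theorem addCompound_single_of_mem {n k : ℕ} {i j : Fin n} (hij : i ≠ j) (α β : IncSeq k n)
    (hi : ∃ s, β s = i) : addCompound k (Matrix.single i j 1) α β = 0 := by
  by_cases hj : ∀ s, β s ≠ j
  · exact addCompound_single_of_notMem i j α β hj
  · push Not at hj
    obtain ⟨s, rfl⟩ := hj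
    obtain ⟨t, rfl⟩ := hi
    have hts : t ≠ s := fun h => hij (h ▸ rfl)
    rw [addCompound_single_apply]
    refine Matrix.det_zero_of_column_eq hts fun r => ?_
    simp [hts, Matrix.one_apply]

theorem addCompound_single_self {n k : ℕ} {i j : Fin n} (hij : i ≠ j) (β : IncSeq k n) :
    addCompound k (Matrix.single i j 1) β β = 0 := by
  by_cases hi : ∃ s, β s = i
  · exact addCompound_single_of_mem hij β β hi
  by_cases hj : ∀ s, β s ≠ j
  · exact addCompound_single_of_notMem i j β β hj
  push Not at hj hi
  obtain ⟨s, rfl⟩ := hj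
  rw [addCompound_single_apply]
  refine Matrix.det_eq_zero_of_column_eq_zero s fun r => ?_
  simp [hi r]

theorem exists_perm_of_det_one_submatrix_ne_zero {n k : ℕ} {α : IncSeq k n} {γ : Fin k → Fin n}
    (hγ : Function.Injective γ)
    (h : ((1 : Matrix (Fin n) (Fin n) ℝ).submatrix α γ).det ≠ 0) :
    ∃ σ : Equiv.Perm (Fin k), γ = α ∘ σ := by
  have hc : ∀ c, ∃ r, γ c = α r := by
    by_contra! hc
    obtain ⟨c, hc⟩ := hc
    exact h (Matrix.det_eq_zero_of_column_eq_zero c fun r => Matrix.one_apply_ne (hc r).symm)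
  choose σ hσ using hc
  have hinj : Function.Injective σ := fun a b hab => hγ (by rw [hσ, hσ, hab])
  exact ⟨Equiv.ofBijective σ (Finite.injective_iff_bijective.mp hinj), funext hσ⟩

/-- A nonzero minor of the identity forces `α` and `γ` to have the same range. An increasing
sequence is determined by its range, so at most one `α` contributes, and its minor is the sign of a
permutation. -/
theorem sum_abs_det_one_submatrix_le {n k : ℕ} {γ : Fin k → Fin n}
    (hγ : Function.Injective γ) :
    ∑ α : IncSeq k n, |((1 : Matrix (Fin n) (Fin n) ℝ).submatrix α γ).det| ≤ 1 := by
  by_cases h : ∃ α : IncSeq k n, ((1 : Matrix (Fin n) (Fin n) ℝ).submatrix α γ).det ≠ 0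
  · obtain ⟨α, hα⟩ := h
    obtain ⟨σ, rfl⟩ := exists_perm_of_det_one_submatrix_ne_zero hγ hα
    rw [Finset.sum_eq_single α]
    · have : (1 : Matrix (Fin n) (Fin n) ℝ).submatrix α (α ∘ σ) =
          (1 : Matrix (Fin k) (Fin k) ℝ).submatrix id σ := by
        ext r c
        simp [Matrix.one_apply]
      rw [this, Matrix.det_permute', Matrix.det_one, mul_one]
      rcases Int.units_eq_one_or (Equiv.Perm.sign σ) with h | h <;> simp [h]
    · intro α' _ hne
      by_contra h0
      obtain ⟨τ, hτ⟩ := exists_perm_of_det_one_submatrix_ne_zero hγ (abs_ne_zero.mp h0)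
      refine hne (OrderEmbedding.range_inj.mp ?_)
      have := congrArg Set.range hτ
      rw [EquivLike.range_comp, EquivLike.range_comp] at this
      exact this.symm
    · simp
  · push Not at h
    simp [h]

/-- The slope determinant has `j` replaced by `i` in `β`. If `j ∉ β` there is nothing to replace,
and if `i ∈ β` a column repeats. Otherwise the new index sequence is injective. -/
theorem sum_abs_addCompound_single_le {n k : ℕ} {i j : Fin n} (hij : i ≠ j) (β : IncSeq k n) :
    ∑ α, |addCompound k (Matrix.single i j 1) α β| ≤
      if j ∈ Finset.univ.image β ∧ i ∈ (Finset.univ.image β)ᶜ then 1 else 0 := by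
  by_cases hi : ∃ s, β s = i
  · rw [Finset.sum_eq_zero fun α _ => by rw [addCompound_single_of_mem hij α β hi, abs_zero]]
    split_ifs <;> norm_num
  by_cases hj : ∀ s, β s ≠ j
  · rw [Finset.sum_eq_zero fun α _ => by rw [addCompound_single_of_notMem i j α β hj, abs_zero]]
    split_ifs <;> norm_num
  push Not at hi hj
  obtain ⟨s, rfl⟩ := hj
  rw [if_pos (by simpa using hi)]
  simp only [addCompound_single_apply]
  refine sum_abs_det_one_submatrix_le fun a b hab => ?_
  by_cases ha : a = s <;> by_cases hb : b = s
  · rw [ha, hb]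
  · subst ha
    simp only [if_true, if_neg hb] at hab
    exact absurd hab.symm (hi b)
  · subst hb
    simp only [if_true, if_neg ha] at hab
    exact absurd hab (hi a)
  · simp only [if_neg ha, if_neg hb] at hab
    exact β.injective hab

theorem addCompound_decomp {n : ℕ} (k : ℕ) (B : Matrix (Fin n) (Fin n) ℝ) :
    addCompound k B = (Matrix.diagonal fun α : IncSeq k n => ∑ r, B (α r) (α r)) +
      ∑ x ∈ Finset.univ.offDiag, B x.1 x.2 • addCompound k (Matrix.single x.1 x.2 1) := by
  rw [← addCompound_diagonal k fun i => B i i, ← addCompound_sum_smul, ← addCompound_add]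
  congr 1
  ext i j
  simp only [Matrix.add_apply, Matrix.sum_apply, Matrix.smul_apply, smul_eq_mul,
    Matrix.single_apply]
  by_cases h : i = j
  · subst h
    rw [Finset.sum_eq_zero, Matrix.diagonal_apply_eq, add_zero]
    rintro ⟨a, b⟩ hab
    have : a ≠ b := by simpa using hab
    rw [if_neg (fun hc => this (hc.1.trans hc.2.symm)), mul_zero]
  · rw [Finset.sum_eq_single (i, j), Matrix.diagonal_apply_ne _ h]
    · simp
    · rintro ⟨a, b⟩ _ hne
      rw [if_neg (fun hc => hne (Prod.ext hc.1 hc.2)), mul_zero]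
    · intro hc
      simp [h] at hc

theorem addCompound_apply_self {n : ℕ} (k : ℕ) (B : Matrix (Fin n) (Fin n) ℝ)
    (β : IncSeq k n) : addCompound k B β β = ∑ i ∈ Finset.univ.image β, B i i := by
  rw [addCompound_decomp, Matrix.add_apply, Matrix.sum_apply, Finset.sum_eq_zero, add_zero,
    Matrix.diagonal_apply_eq, Finset.sum_image fun _ _ _ _ h => β.injective h]
  intro x hx
  rw [Matrix.smul_apply, addCompound_single_self (by simpa using hx), smul_zero]

theorem sum_abs_addCompound_le {n : ℕ} (k : ℕ) (B : Matrix (Fin n) (Fin n) ℝ)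
    (β : IncSeq k n) :
    ∑ α ∈ Finset.univ.erase β, |addCompound k B α β| ≤
      ∑ i ∈ (Finset.univ.image β)ᶜ, ∑ j ∈ Finset.univ.image β, |B i j| := by
  calc ∑ α ∈ Finset.univ.erase β, |addCompound k B α β|
      ≤ ∑ α ∈ Finset.univ.erase β, ∑ x ∈ Finset.univ.offDiag,
          |B x.1 x.2| * |addCompound k (Matrix.single x.1 x.2 1) α β| := by
        refine Finset.sum_le_sum fun α hα => ?_
        rw [addCompound_decomp, Matrix.add_apply, Matrix.sum_apply,
          Matrix.diagonal_apply_ne _ (Finset.ne_of_mem_erase hα), zero_add]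
        refine (Finset.abs_sum_le_sum_abs _ _).trans_eq ?_
        simp only [Matrix.smul_apply, smul_eq_mul, abs_mul]
    _ ≤ ∑ α, ∑ x ∈ Finset.univ.offDiag,
          |B x.1 x.2| * |addCompound k (Matrix.single x.1 x.2 1) α β| :=
        Finset.sum_le_sum_of_subset_of_nonneg (Finset.subset_univ _) fun _ _ _ =>
          Finset.sum_nonneg fun _ _ => by positivity
    _ = ∑ x ∈ Finset.univ.offDiag,
          |B x.1 x.2| * ∑ α, |addCompound k (Matrix.single x.1 x.2 1) α β| := by
        rw [Finset.sum_comm]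
        simp only [Finset.mul_sum]
    _ ≤ ∑ x ∈ Finset.univ.offDiag, |B x.1 x.2| *
          if x.2 ∈ Finset.univ.image β ∧ x.1 ∈ (Finset.univ.image β)ᶜ then 1 else 0 :=
        Finset.sum_le_sum fun x hx => mul_le_mul_of_nonneg_left
          (sum_abs_addCompound_single_le (by simpa using hx) β) (abs_nonneg _)
    _ ≤ ∑ x : Fin n × Fin n, |B x.1 x.2| *
          if x.2 ∈ Finset.univ.image β ∧ x.1 ∈ (Finset.univ.image β)ᶜ then 1 else 0 :=
        Finset.sum_le_sum_of_subset_of_nonneg (Finset.subset_univ _) fun _ _ _ => by positivity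
    _ = _ := by
        simp only [mul_ite, mul_one, mul_zero]
        rw [← Finset.sum_filter, ← Finset.sum_product']
        refine Finset.sum_congr ?_ fun _ _ => rfl
        ext x
        simp only [Finset.mem_filter_univ, Finset.mem_product, and_comm]

/-- Each of the `n - k` indices `i` outside the range `R` of `β` contributes `-B i i` (from
completing the trace) plus the `|B i j|` with `j ∈ R`, which is part of the `i`-th row sum of `-B`.
Columns of the compound are thus controlled by rows of `-B`, whence the dual exponent. -/
theorem addCompound_colSum_le {n k : ℕ} (B : Matrix (Fin n) (Fin n) ℝ) {c : ℝ}
    (hc : ∀ i, -B i i + ∑ j ∈ Finset.univ.erase i, |B i j| ≤ c) (β : IncSeq k n) :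
    addCompound k B β β + ∑ α ∈ Finset.univ.erase β, |addCompound k B α β| ≤
      B.trace + ((n : ℝ) - k) * c := by
  set R := Finset.univ.image β with hR
  have hcard : (Rᶜ.card : ℝ) = n - k := by
    have h := Finset.card_add_card_compl R
    rw [hR, Finset.card_image_of_injective _ β.injective, ← hR] at h
    simp only [Finset.card_univ, Fintype.card_fin] at h
    have h' : (k : ℝ) + Rᶜ.card = n := by exact_mod_cast h
    linarith
  have htr : B.trace = ∑ i ∈ R, B i i + ∑ i ∈ Rᶜ, B i i :=
    (Finset.sum_add_sum_compl R _).symm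
  have hsum : ∑ i ∈ Rᶜ, (-B i i + ∑ j ∈ R, |B i j|) ≤ (n - k) * c := by
    rw [← hcard, ← nsmul_eq_mul]
    refine Finset.sum_le_card_nsmul _ _ _ fun i hi => le_trans ?_ (hc i)
    gcongr
    intro j hj
    refine Finset.mem_erase.mpr ⟨?_, Finset.mem_univ _⟩
    rintro rfl
    exact Finset.mem_compl.mp hi hj
  rw [Finset.sum_add_distrib, Finset.sum_neg_distrib] at hsum
  have := sum_abs_addCompound_le k B β
  rw [addCompound_apply_self, htr]
  linarith

/-! ### Log norms for the exponents 1, 2 and ∞ -/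

theorem norm_toLp_two_sq {ι : Type*} [Fintype ι] (x : ι → ℝ) : ‖WithLp.toLp 2 x‖ ^ 2 = x ⬝ᵥ x := by
  rw [EuclideanSpace.real_norm_sq_eq]
  exact Finset.sum_congr rfl fun i _ => pow_two _

theorem dotProduct_le_norm_mul_norm {ι : Type*} [Fintype ι] (x y : ι → ℝ) :
    x ⬝ᵥ y ≤ ‖WithLp.toLp 2 x‖ * ‖WithLp.toLp 2 y‖ := by
  have := real_inner_le_norm (WithLp.toLp 2 y) (WithLp.toLp 2 x)
  rw [EuclideanSpace.inner_toLp_toLp, mul_comm] at this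
  exact this

section LogNorm

variable {ι : Type*} [Fintype ι] [DecidableEq ι]

theorem inducedNorm_le {p : ℝ≥0∞} [Fact (1 ≤ p)] {M : Matrix ι ι ℝ} {C : ℝ} (hC : 0 ≤ C)
    (h : ∀ x : ι → ℝ, ‖WithLp.toLp p (M *ᵥ x)‖ ≤ C * ‖WithLp.toLp p x‖) :
    inducedNorm p M ≤ C :=
  ContinuousLinearMap.opNorm_le_bound _ hC fun x => h x.ofLp

theorem norm_mulVec_le_inducedNorm (p : ℝ≥0∞) [Fact (1 ≤ p)] (M : Matrix ι ι ℝ) (x : ι → ℝ) :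
    ‖WithLp.toLp p (M *ᵥ x)‖ ≤ inducedNorm p M * ‖WithLp.toLp p x‖ :=
  (Matrix.toLpLin p p M).toContinuousLinearMap.le_opNorm (WithLp.toLp p x)

theorem inducedNorm_one_le {M : Matrix ι ι ℝ} {C : ℝ} (hC : 0 ≤ C)
    (h : ∀ j, ∑ i, |M i j| ≤ C) : inducedNorm 1 M ≤ C := by
  refine inducedNorm_le hC fun x => ?_
  simp only [PiLp.norm_eq_of_L1, Real.norm_eq_abs, Matrix.mulVec, dotProduct]
  calc ∑ i, |∑ j, M i j * x j| ≤ ∑ i, ∑ j, |M i j| * |x j| :=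
        Finset.sum_le_sum fun i _ =>
          (Finset.abs_sum_le_sum_abs _ _).trans_eq (by simp only [abs_mul])
    _ = ∑ j, (∑ i, |M i j|) * |x j| := by
        rw [Finset.sum_comm]
        simp only [Finset.sum_mul]
    _ ≤ ∑ j, C * |x j| :=
        Finset.sum_le_sum fun j _ => mul_le_mul_of_nonneg_right (h j) (abs_nonneg _)
    _ = C * ∑ j, |x j| := (Finset.mul_sum _ _ _).symm

theorem sum_abs_col_le_inducedNorm_one (M : Matrix ι ι ℝ) (j : ι) :
    ∑ i, |M i j| ≤ inducedNorm 1 M := by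
  have h := norm_mulVec_le_inducedNorm 1 M (Pi.single j 1)
  have h1 : ‖WithLp.toLp 1 (Pi.single j (1 : ℝ) : ι → ℝ)‖ = 1 :=
    (PiLp.norm_single 1 (fun _ : ι => ℝ) j 1).trans norm_one
  rw [h1, mul_one, PiLp.norm_eq_of_L1] at h
  simpa using h

theorem inducedNorm_top_le {M : Matrix ι ι ℝ} {C : ℝ} (hC : 0 ≤ C)
    (h : ∀ i, ∑ j, |M i j| ≤ C) : inducedNorm ∞ M ≤ C := by
  refine inducedNorm_le hC fun x => ?_
  rw [PiLp.norm_toLp, PiLp.norm_toLp, pi_norm_le_iff_of_nonneg (by positivity)]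
  intro i
  rw [Real.norm_eq_abs]
  calc |∑ j, M i j * x j| ≤ ∑ j, |M i j| * ‖x‖ := by
        refine (Finset.abs_sum_le_sum_abs _ _).trans (Finset.sum_le_sum fun j _ => ?_)
        rw [abs_mul]
        exact mul_le_mul_of_nonneg_left (norm_le_pi_norm x j) (abs_nonneg _)
    _ ≤ C * ‖x‖ := by
        rw [← Finset.sum_mul]
        exact mul_le_mul_of_nonneg_right (h i) (norm_nonneg _)

theorem inducedNorm_nonneg (p : ℝ≥0∞) [Fact (1 ≤ p)] (M : Matrix ι ι ℝ) :
    0 ≤ inducedNorm p M :=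
  norm_nonneg _

theorem sum_abs_row_le_inducedNorm_top (M : Matrix ι ι ℝ) (i : ι) :
    ∑ j, |M i j| ≤ inducedNorm ∞ M := by
  -- The sign vector of row `i` has sup norm at most 1 and attains the absolute row sum.
  have h := norm_mulVec_le_inducedNorm ∞ M fun j => (SignType.sign (M i j) : ℝ)
  rw [PiLp.norm_toLp, PiLp.norm_toLp] at h
  have h1 : ‖fun j => (SignType.sign (M i j) : ℝ)‖ ≤ 1 := by
    rw [pi_norm_le_iff_of_nonneg zero_le_one]
    intro j
    rcases SignType.trichotomy (SignType.sign (M i j)) with h | h | h <;> simp [h]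
  have h2 : ∑ j, |M i j| ≤ ‖M *ᵥ fun j => (SignType.sign (M i j) : ℝ)‖ := by
    refine le_trans (le_of_eq ?_) ((Real.le_norm_self _).trans
      (norm_le_pi_norm (M *ᵥ fun j => (SignType.sign (M i j) : ℝ)) i))
    exact Finset.sum_congr rfl fun j _ => (self_mul_sign _).symm
  exact h2.trans (h.trans (mul_le_of_le_one_right (inducedNorm_nonneg _ _) h1))

theorem sum_abs_one_add_smul_col (M : Matrix ι ι ℝ) (ε : ℝ) (j : ι) :
    ∑ i, |(1 + ε • M) i j| = |1 + ε * M j j| + |ε| * ∑ i ∈ Finset.univ.erase j, |M i j| := by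
  rw [← Finset.add_sum_erase _ _ (Finset.mem_univ j), Finset.mul_sum]
  congr 1
  · simp
  · refine Finset.sum_congr rfl fun i hi => ?_
    simp [Matrix.one_apply_ne (Finset.ne_of_mem_erase hi), abs_mul]

theorem sum_abs_one_add_smul_row (M : Matrix ι ι ℝ) (ε : ℝ) (i : ι) :
    ∑ j, |(1 + ε • M) i j| = |1 + ε * M i i| + |ε| * ∑ j ∈ Finset.univ.erase i, |M i j| := by
  refine Eq.trans ?_ (sum_abs_one_add_smul_col Mᵀ ε i)
  simp [Matrix.one_apply, eq_comm]

theorem eventually_nonneg_one_add_mul (a : ℝ) : ∀ᶠ ε : ℝ in 𝓝[>] 0, 0 ≤ 1 + ε * a := by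
  have h : Filter.Tendsto (fun ε : ℝ => 1 + ε * a) (𝓝 0) (𝓝 (1 + 0 * a)) :=
    Continuous.tendsto (by fun_prop) 0
  have h1 : ∀ᶠ ε : ℝ in 𝓝 0, 0 < 1 + ε * a := h.eventually (lt_mem_nhds (by simp))
  exact (h1.filter_mono nhdsWithin_le_nhds).mono fun _ h => h.le

variable [Nonempty ι]

/-- The second-order slack `ε ^ 2 * d` disappears in the limit; the Euclidean case needs it. -/
theorem logNorm_le_of_eventually {p : ℝ≥0∞} [Fact (1 ≤ p)] {M : Matrix ι ι ℝ} {c d : ℝ}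
    (h : ∀ᶠ ε in 𝓝[>] (0 : ℝ), inducedNorm p (1 + ε • M) ≤ 1 + ε * c + ε ^ 2 * d) :
    logNorm p M ≤ c := by
  have h2 : Filter.Tendsto (fun ε : ℝ => c + ε * d) (𝓝[>] 0) (𝓝 c) := by
    have : Filter.Tendsto (fun ε : ℝ => c + ε * d) (𝓝 0) (𝓝 (c + 0 * d)) :=
      Continuous.tendsto (by fun_prop) 0
    rw [zero_mul, add_zero] at this
    exact this.mono_left nhdsWithin_le_nhds
  refine le_of_tendsto_of_tendsto (tendsto_logNorm p M) h2 ?_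
  filter_upwards [h, self_mem_nhdsWithin] with ε h1 (hε : 0 < ε)
  rw [div_le_iff₀ hε]
  linarith

theorem le_logNorm_of_forall {p : ℝ≥0∞} [Fact (1 ≤ p)] {M : Matrix ι ι ℝ} {c : ℝ}
    (h : ∀ ε : ℝ, 0 < ε → 1 + ε * c ≤ inducedNorm p (1 + ε • M)) : c ≤ logNorm p M := by
  refine ge_of_tendsto (tendsto_logNorm p M) ?_
  filter_upwards [self_mem_nhdsWithin] with ε (hε : 0 < ε)
  rw [le_div_iff₀ hε]
  linarith [h ε hε]

theorem logNorm_one_le {M : Matrix ι ι ℝ} {c : ℝ}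
    (h : ∀ j, M j j + ∑ i ∈ Finset.univ.erase j, |M i j| ≤ c) : logNorm 1 M ≤ c := by
  refine logNorm_le_of_eventually (d := 0) ?_
  filter_upwards [Filter.eventually_all.2 fun j => eventually_nonneg_one_add_mul (M j j),
    eventually_nonneg_one_add_mul c, self_mem_nhdsWithin] with ε h1 hc (hε : 0 < ε)
  rw [mul_zero, add_zero]
  refine inducedNorm_one_le hc fun j => ?_
  rw [sum_abs_one_add_smul_col, abs_of_nonneg (h1 j), abs_of_pos hε]
  linarith [mul_le_mul_of_nonneg_left (h j) hε.le]

theorem logNorm_top_le {M : Matrix ι ι ℝ} {c : ℝ}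
    (h : ∀ i, M i i + ∑ j ∈ Finset.univ.erase i, |M i j| ≤ c) : logNorm ∞ M ≤ c := by
  refine logNorm_le_of_eventually (d := 0) ?_
  filter_upwards [Filter.eventually_all.2 fun j => eventually_nonneg_one_add_mul (M j j),
    eventually_nonneg_one_add_mul c, self_mem_nhdsWithin] with ε h1 hc (hε : 0 < ε)
  rw [mul_zero, add_zero]
  refine inducedNorm_top_le hc fun j => ?_
  rw [sum_abs_one_add_smul_row, abs_of_nonneg (h1 j), abs_of_pos hε]
  linarith [mul_le_mul_of_nonneg_left (h j) hε.le]

theorem le_logNorm_one (M : Matrix ι ι ℝ) (j : ι) :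
    M j j + ∑ i ∈ Finset.univ.erase j, |M i j| ≤ logNorm 1 M := by
  refine le_logNorm_of_forall fun ε hε => le_trans ?_ (sum_abs_col_le_inducedNorm_one _ j)
  rw [sum_abs_one_add_smul_col, abs_of_pos hε]
  linarith [le_abs_self (1 + ε * M j j)]

theorem le_logNorm_top (M : Matrix ι ι ℝ) (i : ι) :
    M i i + ∑ j ∈ Finset.univ.erase i, |M i j| ≤ logNorm ∞ M := by
  refine le_logNorm_of_forall fun ε hε => le_trans ?_ (sum_abs_row_le_inducedNorm_top _ i)
  rw [sum_abs_one_add_smul_row, abs_of_pos hε]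
  linarith [le_abs_self (1 + ε * M i i)]

theorem logNorm_two_le {M : Matrix ι ι ℝ} {c : ℝ} (h : ∀ x, x ⬝ᵥ M *ᵥ x ≤ c * (x ⬝ᵥ x)) :
    logNorm 2 M ≤ c := by
  set K := inducedNorm 2 M with hK
  -- With `K ^ 2 / 2`, the square of `1 + ε c + ε² K² / 2` dominates `1 + 2 ε c + ε² K²`, which
  -- bounds `|(1 + ε M) x|² / |x|²` for `x ≠ 0`.
  refine logNorm_le_of_eventually (d := K ^ 2 / 2) ?_
  have hK0 : 0 ≤ K := inducedNorm_nonneg _ _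
  filter_upwards [eventually_nonneg_one_add_mul c, self_mem_nhdsWithin] with ε hc (hε : 0 < ε)
  have hC : 0 ≤ 1 + ε * c + ε ^ 2 * (K ^ 2 / 2) := by positivity
  refine inducedNorm_le hC fun x => ?_
  refine abs_le_of_sq_le_sq' ?_ (by positivity) |>.2
  have e1 : ‖WithLp.toLp 2 ((1 + ε • M) *ᵥ x)‖ ^ 2 =
      x ⬝ᵥ x + 2 * ε * (x ⬝ᵥ M *ᵥ x) + ε ^ 2 * ‖WithLp.toLp 2 (M *ᵥ x)‖ ^ 2 := by
    rw [norm_toLp_two_sq, norm_toLp_two_sq, Matrix.add_mulVec, Matrix.one_mulVec,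
      Matrix.smul_mulVec, add_dotProduct, dotProduct_add, dotProduct_add, smul_dotProduct,
      smul_dotProduct, dotProduct_smul, dotProduct_smul, dotProduct_comm (M *ᵥ x) x]
    simp only [smul_eq_mul]
    ring
  have e2 := pow_le_pow_left₀ (norm_nonneg _) (norm_mulVec_le_inducedNorm 2 M x) 2
  rw [mul_pow, norm_toLp_two_sq x, ← hK] at e2
  rw [e1, mul_pow, norm_toLp_two_sq x]
  have hx : 0 ≤ x ⬝ᵥ x := by rw [← norm_toLp_two_sq]; positivity
  have e3 := mul_le_mul_of_nonneg_left (h x) (by positivity : 0 ≤ 2 * ε)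
  have e4 := mul_le_mul_of_nonneg_left e2 (by positivity : 0 ≤ ε ^ 2)
  have e5 : 0 ≤ (ε * c + ε ^ 2 * (K ^ 2 / 2)) ^ 2 * (x ⬝ᵥ x) := by positivity
  linarith

/-- Cauchy–Schwarz bounds `x ⬝ᵥ (1 + ε M) x` by the induced norm of `1 + ε M` times `|x|²`; the
terms of first order in `ε` give the claim. -/
theorem dotProduct_mulVec_le_logNorm_two (M : Matrix ι ι ℝ) (x : ι → ℝ) :
    x ⬝ᵥ M *ᵥ x ≤ logNorm 2 M * (x ⬝ᵥ x) := by
  rcases eq_or_ne x 0 with rfl | hx0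
  · simp
  have hx : 0 < x ⬝ᵥ x := by
    rw [← norm_toLp_two_sq]
    have : WithLp.toLp 2 x ≠ 0 := by simpa using hx0
    positivity
  rw [← div_le_iff₀ hx]
  refine le_logNorm_of_forall fun ε hε => ?_
  have h1 := dotProduct_le_norm_mul_norm x ((1 + ε • M) *ᵥ x)
  have h2 := mul_le_mul_of_nonneg_left (norm_mulVec_le_inducedNorm 2 (1 + ε • M) x)
    (norm_nonneg (WithLp.toLp 2 x))
  have h3 : x ⬝ᵥ ((1 + ε • M) *ᵥ x) = x ⬝ᵥ x + ε * (x ⬝ᵥ M *ᵥ x) := by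
    simp [Matrix.add_mulVec, Matrix.smul_mulVec]
  have h4 := norm_toLp_two_sq x
  have h5 : x ⬝ᵥ x + ε * (x ⬝ᵥ M *ᵥ x) ≤ inducedNorm 2 (1 + ε • M) * (x ⬝ᵥ x) := by
    rw [← h3, ← h4]
    linarith
  rw [← div_le_iff₀ hx] at h5
  refine le_of_eq_of_le ?_ h5
  field_simp

end LogNorm

/-! ### The Euclidean case through the symmetric part -/

theorem dotProduct_symmPart_mulVec {ι : Type*} [Fintype ι] (M : Matrix ι ι ℝ) (x : ι → ℝ) :
    x ⬝ᵥ ((1 / 2 : ℝ) • (M + Mᵀ)) *ᵥ x = x ⬝ᵥ M *ᵥ x := by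
  have h : x ⬝ᵥ Mᵀ *ᵥ x = x ⬝ᵥ M *ᵥ x := by
    rw [Matrix.mulVec_transpose, dotProduct_comm, Matrix.dotProduct_mulVec]
  rw [Matrix.smul_mulVec, Matrix.add_mulVec, dotProduct_smul, dotProduct_add, h, smul_eq_mul]
  ring

theorem dotProduct_conj_mulVec {ι : Type*} [Fintype ι] (U D : Matrix ι ι ℝ) (x : ι → ℝ) :
    x ⬝ᵥ (U * D * Uᵀ) *ᵥ x = (Uᵀ *ᵥ x) ⬝ᵥ D *ᵥ (Uᵀ *ᵥ x) := by
  rw [← Matrix.mulVec_mulVec, ← Matrix.mulVec_mulVec, Matrix.dotProduct_mulVec,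
    ← Matrix.mulVec_transpose]

theorem exists_orthogonal_diagonalization {n : ℕ} {S : Matrix (Fin n) (Fin n) ℝ}
    (hS : S.IsHermitian) :
    ∃ (U : Matrix (Fin n) (Fin n) ℝ) (d : Fin n → ℝ),
      U * Uᵀ = 1 ∧ Uᵀ * U = 1 ∧ S = U * Matrix.diagonal d * Uᵀ := by
  refine ⟨hS.eigenvectorUnitary, hS.eigenvalues, ?_, ?_, ?_⟩
  · exact Unitary.coe_mul_star_self hS.eigenvectorUnitary
  · exact Unitary.coe_star_mul_self hS.eigenvectorUnitary
  · have h := hS.spectral_theorem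
    rw [Unitary.conjStarAlgAut_apply] at h
    exact h

/-- The column-sum bound for a diagonal matrix, where the off-diagonal terms vanish. -/
theorem sum_embedding_le {n k : ℕ} (d : Fin n → ℝ) {c : ℝ} (hd : ∀ i, -d i ≤ c)
    (α : IncSeq k n) : ∑ r, d (α r) ≤ ∑ i, d i + ((n : ℝ) - k) * c := by
  have h := addCompound_colSum_le (Matrix.diagonal d) (c := c) (fun i => by
    rw [Finset.sum_eq_zero fun j hj => by
      rw [Matrix.diagonal_apply_ne' _ (Finset.ne_of_mem_erase hj), abs_zero]]
    simpa using hd i) α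
  refine le_trans ?_ (h.trans_eq (by rw [Matrix.trace_diagonal]))
  rw [addCompound_diagonal, Matrix.diagonal_apply_eq]
  exact le_add_of_nonneg_right (Finset.sum_nonneg fun _ _ => abs_nonneg _)

/-- If `S = U D Uᵀ` is the symmetric part of `B`, then by linearity `S^{[k]}` is the symmetric part
of `B^{[k]}`. It is diagonalized by the orthogonal matrix `U^{(k)}`, with sums of `k` eigenvalues of
`S` on the diagonal. -/
theorem dotProduct_addCompound_mulVec_le {n k : ℕ} [Nonempty (Fin n)]
    (B : Matrix (Fin n) (Fin n) ℝ) (y : IncSeq k n → ℝ) :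
    y ⬝ᵥ addCompound k B *ᵥ y ≤
      (B.trace + ((n : ℝ) - k) * logNorm 2 (-B)) * (y ⬝ᵥ y) := by
  set S := (1 / 2 : ℝ) • (B + Bᵀ) with hSdef
  have hS : S.IsHermitian := by
    rw [Matrix.IsHermitian, Matrix.conjTranspose_eq_transpose_of_trivial, hSdef]
    simp [add_comm]
  have htr : S.trace = B.trace := by
    rw [hSdef, Matrix.trace_smul, Matrix.trace_add, Matrix.trace_transpose, smul_eq_mul]
    ring
  obtain ⟨U, d, hU, hU', hSU⟩ := exists_orthogonal_diagonalization hS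
  have hUinv : U⁻¹ = Uᵀ := Matrix.inv_eq_right_inv hU
  have hUunit : IsUnit U := ⟨⟨U, Uᵀ, hU, hU'⟩, rfl⟩
  -- Testing the quadratic form of `-B` on the unit eigenvector `U e_i` yields `-d i`.
  have hd (i : Fin n) : -d i ≤ logNorm 2 (-B) := by
    have h := dotProduct_mulVec_le_logNorm_two (-B) (U *ᵥ Pi.single i 1)
    have hz : Uᵀ *ᵥ (U *ᵥ Pi.single i 1) = Pi.single i 1 := by
      rw [Matrix.mulVec_mulVec, hU', Matrix.one_mulVec]
    have hn : (U *ᵥ Pi.single i 1) ⬝ᵥ (U *ᵥ Pi.single i 1) = 1 := by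
      rw [Matrix.dotProduct_mulVec, ← Matrix.mulVec_transpose, hz]
      simp
    rw [Matrix.neg_mulVec, dotProduct_neg, ← dotProduct_symmPart_mulVec B, ← hSdef, hSU,
      dotProduct_conj_mulVec, hz, hn] at h
    simpa using h
  have hsum : ∑ i, d i = B.trace := by
    rw [← htr, hSU, Matrix.trace_mul_comm, ← Matrix.mul_assoc, hU', Matrix.one_mul,
      Matrix.trace_diagonal]
  have hSk : (1 / 2 : ℝ) • (addCompound k B + (addCompound k B)ᵀ) =
      mulCompound k U * Matrix.diagonal (fun α : IncSeq k n => ∑ r, d (α r)) *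
        (mulCompound k U)ᵀ := by
    rw [← addCompound_transpose, ← addCompound_add, ← addCompound_smul, ← hSdef, hSU, ← hUinv,
      addCompound_conj k hUunit, addCompound_diagonal, mulCompound_inv k hUunit, hUinv,
      mulCompound_transpose]
  set z := (mulCompound k U)ᵀ *ᵥ y with hz
  have hzz : z ⬝ᵥ z = y ⬝ᵥ y := by
    rw [hz, Matrix.dotProduct_mulVec, ← Matrix.mulVec_transpose, Matrix.transpose_transpose,
      Matrix.mulVec_mulVec, ← mulCompound_transpose, ← mulCompound_mul, hU, mulCompound_one,
      Matrix.one_mulVec]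
  rw [← dotProduct_symmPart_mulVec, hSk, dotProduct_conj_mulVec, ← hzz, ← hz, dotProduct,
    dotProduct, Finset.mul_sum]
  refine Finset.sum_le_sum fun α _ => ?_
  rw [Matrix.mulVec_diagonal]
  nlinarith [mul_le_mul_of_nonneg_right (sum_embedding_le d hd α) (mul_self_nonneg (z α))]

/-! ### The log norm inequality -/

theorem logNorm_addCompound_le {n k : ℕ} (hk : 1 ≤ k) (hkn : k ≤ n) (p q : ℝ≥0∞)
    [Fact (1 ≤ p)] [Fact (1 ≤ q)] (hp : p = 1 ∨ p = 2 ∨ p = ∞) (hpq : p⁻¹ + q⁻¹ = 1)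
    (B : Matrix (Fin n) (Fin n) ℝ) :
    logNorm p (addCompound k B) ≤ B.trace + ((n : ℝ) - k) * logNorm q (-B) := by
  have : Nonempty (Fin n) := ⟨⟨0, by omega⟩⟩
  have : Nonempty (IncSeq k n) := ⟨Fin.castLEOrderEmb hkn⟩
  rcases hp with rfl | rfl | rfl
  · obtain rfl : q = ∞ := by
      rw [inv_one] at hpq
      exact ENNReal.inv_eq_zero.mp
        ((ENNReal.add_right_inj ENNReal.one_ne_top).mp (hpq.trans (add_zero 1).symm))
    refine logNorm_one_le fun β => addCompound_colSum_le B (fun i => ?_) β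
    simpa using le_logNorm_top (-B) i
  · obtain rfl : q = 2 := by
      rw [← ENNReal.inv_two_add_inv_two] at hpq
      exact inv_inj.mp ((ENNReal.add_right_inj (by simp)).mp hpq)
    exact logNorm_two_le fun y => dotProduct_addCompound_mulVec_le B y
  · obtain rfl : q = 1 := by simpa using hpq
    refine logNorm_top_le fun β => ?_
    -- Rows of `-Bᵀ` are columns of `-B`, so the hypothesis is a bound by `μ_1(-B)`, and columns of
    -- `(Bᵀ)^{[k]}` are rows of `B^{[k]}`.
    have h := addCompound_colSum_le (k := k) Bᵀ (fun i => by
      simpa using le_logNorm_one (-B) i) β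
    simpa [addCompound_transpose] using h

theorem scaledLogNorm_addCompound_le {n k : ℕ} (hk : 1 ≤ k) (hkn : k ≤ n) (p q : ℝ≥0∞)
    [Fact (1 ≤ p)] [Fact (1 ≤ q)] (hp : p = 1 ∨ p = 2 ∨ p = ∞) (hpq : p⁻¹ + q⁻¹ = 1)
    {T : Matrix (Fin n) (Fin n) ℝ} (hT : IsUnit T) (A : Matrix (Fin n) (Fin n) ℝ) :
    scaledLogNorm p (mulCompound k T) (addCompound k A) ≤ kShiftedLogNorm q T k A := by
  have h := logNorm_addCompound_le hk hkn p q hp hpq (T * A * T⁻¹)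
  have htr : (T * A * T⁻¹).trace = A.trace := by
    rw [Matrix.trace_mul_comm, ← Matrix.mul_assoc,
      Matrix.nonsing_inv_mul _ ((Matrix.isUnit_iff_isUnit_det _).mp hT), Matrix.one_mul]
  rw [addCompound_conj k hT, htr] at h
  simpa only [scaledLogNorm, kShiftedLogNorm, Matrix.mul_neg, Matrix.neg_mul] using h

/-! ### Dynamics of the compound vector and exponential decay -/

/-- With `W` the matrix of the `w j`, the curves `u ↦ W(u)` at `t` and `ε ↦ (1 + ε J) W(t)` at `0`
share position and velocity, so by the chain rule the minors have the same derivative along both.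
Along the second, Cauchy–Binet factors out `(1 + ε J)^{(k)}`. -/
theorem hasDerivWithinAt_compoundVector {n k : ℕ} {w : Fin k → ℝ → Fin n → ℝ}
    {J : Matrix (Fin n) (Fin n) ℝ} {s : Set ℝ} {t : ℝ}
    (h : ∀ j, HasDerivWithinAt (w j) (J *ᵥ w j t) s t) :
    HasDerivWithinAt (fun u => compoundVector fun j => w j u)
      (addCompound k J *ᵥ compoundVector fun j => w j t) s t := by
  refine hasDerivWithinAt_pi.2 fun α => ?_
  have hG := differentiable_det_submatrix (ι := Fin n) (κ := Fin k) α id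
  have hW : HasDerivWithinAt (fun u => (fun i j => w j u i : Fin n → Fin k → ℝ))
      (fun i j => (J *ᵥ w j t) i) s t :=
    hasDerivWithinAt_pi.2 fun i => hasDerivWithinAt_pi.2 fun j => hasDerivWithinAt_pi.1 (h j) i
  have h1 := (hG fun i j => w j t i).hasFDerivAt.comp_hasDerivWithinAt t hW
  have hL : HasDerivAt (fun ε : ℝ => (fun i j => w j t i + ε * (J *ᵥ w j t) i :
      Fin n → Fin k → ℝ)) (fun i j => (J *ᵥ w j t) i) 0 := by
    refine hasDerivAt_pi.2 fun i => hasDerivAt_pi.2 fun j => ?_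
    simpa using ((hasDerivAt_id (0 : ℝ)).mul_const ((J *ᵥ w j t) i)).const_add (w j t i)
  have h2 := (hG fun i j => w j t i + 0 * (J *ᵥ w j t) i).hasFDerivAt.comp_hasDerivAt 0 hL
  simp only [zero_mul, add_zero] at h2
  have h3 : HasDerivAt (fun ε : ℝ => ∑ γ, mulCompound k (1 + ε • J) α γ *
      compoundVector (fun j => w j t) γ)
      ((addCompound k J *ᵥ compoundVector fun j => w j t) α) 0 :=
    HasDerivAt.fun_sum fun γ _ => (hasDerivAt_mulCompound k J α γ).mul_const _
  have h4 (ε : ℝ) : ∑ γ, mulCompound k (1 + ε • J) α γ * compoundVector (fun j => w j t) γ =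
      ((Matrix.of fun i j => w j t i + ε * (J *ᵥ w j t) i).submatrix α id).det := by
    simp only [compoundVector]
    rw [← Matrix.mul_apply, ← mulCompound_mul, Matrix.add_mul, Matrix.one_mul, Matrix.smul_mul]
    rfl
  simp only [h4] at h3
  rw [h3.unique h2]
  exact h1

/-- To first order `z s` is `(1 + (s - t) M t) z t`, so the upper right Dini derivative of `‖z‖` is
at most `μ_p(M t) ‖z t‖`. Grönwall in its Dini form then applies, with no regularity of `M` in time.
-/
theorem norm_le_exp_mul_of_logNorm_le {ι : Type*} [Fintype ι] [DecidableEq ι] [Nonempty ι]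
    {p : ℝ≥0∞} [Fact (1 ≤ p)] {a b η : ℝ} (hab : a ≤ b) {M : ℝ → Matrix ι ι ℝ}
    {z : ℝ → PiLp p fun _ : ι => ℝ}
    (hz : ∀ t ∈ Set.Icc a b,
      HasDerivWithinAt z (WithLp.toLp p (M t *ᵥ (z t).ofLp)) (Set.Icc a b) t)
    (hM : ∀ t ∈ Set.Icc a b, logNorm p (M t) ≤ -η) :
    ‖z b‖ ≤ Real.exp (-η * (b - a)) * ‖z a‖ := by
  have hcont : ContinuousOn (fun t => ‖z t‖) (Set.Icc a b) := fun t ht =>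
    (hz t ht).continuousWithinAt.norm
  have key := le_gronwallBound_of_liminf_deriv_right_le (f := fun t => ‖z t‖)
    (f' := fun t => -η * ‖z t‖) (δ := ‖z a‖) (K := -η) (ε := 0) hcont ?_ le_rfl
    (fun t _ => by simp) b (Set.right_mem_Icc.mpr hab)
  · rw [gronwallBound_ε0] at key
    linarith
  intro t ht r hr
  have htI : t ∈ Set.Icc a b := Set.Ico_subset_Icc_self ht
  set v := WithLp.toLp p (M t *ᵥ (z t).ofLp) with hv
  have hd : HasDerivWithinAt z v (Set.Ioi t) t :=
    ((hz t htI).mono_of_mem_nhdsWithin (Icc_mem_nhdsGT_of_mem ht))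
  rw [hasDerivWithinAt_iff_tendsto_slope' (by simp)] at hd
  have hshift : Filter.Tendsto (fun s => s - t) (𝓝[>] t) (𝓝[>] 0) := by
    refine tendsto_nhdsWithin_iff.2 ⟨?_, ?_⟩
    · have : Filter.Tendsto (fun s => s - t) (𝓝 t) (𝓝 (t - t)) :=
        Continuous.tendsto (by fun_prop) t
      rw [sub_self] at this
      exact this.mono_left nhdsWithin_le_nhds
    · filter_upwards [self_mem_nhdsWithin] with s (hs : t < s)
      exact sub_pos.mpr hs
  have hlim : Filter.Tendsto (fun s => (inducedNorm p (1 + (s - t) • M t) - 1) / (s - t) * ‖z t‖ +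
      ‖slope z t s - v‖) (𝓝[>] t) (𝓝 (logNorm p (M t) * ‖z t‖ + 0)) := by
    refine Filter.Tendsto.add (((tendsto_logNorm p (M t)).comp hshift).mul_const _) ?_
    exact tendsto_iff_norm_sub_tendsto_zero.mp hd
  have hlt : logNorm p (M t) * ‖z t‖ + 0 < r := by
    rw [add_zero]
    exact (mul_le_mul_of_nonneg_right (hM t htI) (norm_nonneg _)).trans_lt hr
  refine Filter.Eventually.frequently ?_
  filter_upwards [hlim.eventually (gt_mem_nhds hlt), self_mem_nhdsWithin] with s hs (hts : t < s)
  refine lt_of_le_of_lt ?_ hs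
  have hpos : 0 < s - t := sub_pos.mpr hts
  have e1 : z s = WithLp.toLp p ((1 + (s - t) • M t) *ᵥ (z t).ofLp) +
      (s - t) • (slope z t s - v) := by
    rw [smul_sub, sub_smul_slope, Matrix.add_mulVec, Matrix.one_mulVec, Matrix.smul_mulVec,
      WithLp.toLp_add, WithLp.toLp_smul, ← hv, vsub_eq_sub, WithLp.toLp_ofLp]
    abel
  have e2 : ‖z s‖ ≤ inducedNorm p (1 + (s - t) • M t) * ‖z t‖ +
      (s - t) * ‖slope z t s - v‖ := by
    calc ‖z s‖ ≤ _ := e1 ▸ norm_add_le _ _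
      _ ≤ _ := by
        rw [norm_smul, Real.norm_of_nonneg hpos.le]
        exact add_le_add_left (norm_mulVec_le_inducedNorm p _ _) _
  rw [inv_mul_le_iff₀ hpos]
  have e3 : (s - t) * ((inducedNorm p (1 + (s - t) • M t) - 1) / (s - t) * ‖z t‖ +
      ‖slope z t s - v‖) = (inducedNorm p (1 + (s - t) • M t) - 1) * ‖z t‖ +
      (s - t) * ‖slope z t s - v‖ := by
    field_simp
  rw [e3]
  linarith

theorem mainTheorem1 (n k : ℕ) (hk : 1 ≤ k) (hkn : k ≤ n) (p q : ℝ≥0∞)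
    [Fact (1 ≤ p)] [Fact (1 ≤ q)] (hp : p = 1 ∨ p = 2 ∨ p = ∞) (hpq : p⁻¹ + q⁻¹ = 1)
    (T : Matrix (Fin n) (Fin n) ℝ) (hT : IsUnit T) :
    (∀ A : Matrix (Fin n) (Fin n) ℝ,
      scaledLogNorm p (mulCompound k T) (addCompound k A) ≤ kShiftedLogNorm q T k A) ∧
    (∀ (Ω : Set (Fin n → ℝ)) (f : ℝ → (Fin n → ℝ) → (Fin n → ℝ)) (η : ℝ), 0 < η →
      (∀ t, 0 ≤ t → ∀ x ∈ Ω, DifferentiableAt ℝ (f t) x) →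
      (∀ t, 0 ≤ t → ∀ x ∈ Ω, kShiftedLogNorm q T k (jacobian f t x) ≤ -η) →
      IsKContracting k p (mulCompound k T) η Ω f) := by
  refine ⟨scaledLogNorm_addCompound_le hk hkn p q hp hpq hT, ?_⟩
  intro Ω f η _ _ hτ t₀ t₁ h0 h01 x w hxΩ _ hw
  have : Nonempty (IncSeq k n) := ⟨Fin.castLEOrderEmb hkn⟩
  set H := mulCompound k T with hH
  have hHinv : H⁻¹ * H = 1 := by
    rw [hH, mulCompound_inv k hT, ← mulCompound_mul,
      Matrix.nonsing_inv_mul _ ((Matrix.isUnit_iff_isUnit_det _).mp hT), mulCompound_one]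
  refine norm_le_exp_mul_of_logNorm_le h01
    (M := fun t => H * addCompound k (jacobian f t (x t)) * H⁻¹)
    (z := fun t => WithLp.toLp p (H *ᵥ compoundVector fun j => w j t)) (fun t ht => ?_)
    (fun t ht => (scaledLogNorm_addCompound_le hk hkn p q hp hpq hT _).trans
      (hτ t (h0.trans ht.1) _ (hxΩ t ht)))
  have hy := hasDerivWithinAt_compoundVector fun j => hw j t ht
  have hL := (LinearMap.toContinuousLinearMap
    ((WithLp.linearEquiv p ℝ (IncSeq k n → ℝ)).symm.toLinearMap ∘ₗ H.mulVecLin)).hasFDerivAt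
      |>.comp_hasDerivWithinAt t hy
  -- In the coordinates `z = H y`, the equation `ẏ = J^{[k]} y` becomes `ż = (H J^{[k]} H⁻¹) z`,
  -- whose matrix has log norm `μ_{p,H}(J^{[k]})`.
  have hM : (H * addCompound k (jacobian f t (x t)) * H⁻¹) *ᵥ
      (H *ᵥ compoundVector fun j => w j t) =
      H *ᵥ (addCompound k (jacobian f t (x t)) *ᵥ compoundVector fun j => w j t) := by
    rw [Matrix.mulVec_mulVec, Matrix.mul_assoc, hHinv, Matrix.mul_one, ← Matrix.mulVec_mulVec]
  rw [hM]
  exact hL
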